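/- Let $N\ge 1$ be the number of clients, $T,L\ge 0$ and $d\ge 0$ integers, $\alpha\in(0,1]$, and let $F_1,\dots,F_N:\mathbb R^d\to\mathbb R$ be continuously differentiable local loss functions. Let parameters $\hat w_i^t\in\mathbb R^d$ ($1\le i\le N$, $0\le t\le T$) at the onset of the global iterations be given. For a family $x=(w_{i,l}^t,g_{i,l}^t)$ of vectors of $\mathbb R^d$ (local parameters and local gradients of all clients $1\le i\le N$ at all local epochs $0\le l\le L$ of all global iterations $0\le t\le T$) define the mean-field terms $$\phi_{1,l}^t=\frac1N\sum_{i=1}^N g_{i,l}^t,\qquad \phi_{2,l}^t=\frac1N\sum_{i=1}^N w_{i,l}^t,$$ and let the adaptive learning rates $\eta_{i,l}^t\in\mathbb R$ be the unique solution of $$\eta_{i,l}^t=\frac{1-\alpha}{\alpha}(\phi_{1,l}^t)^{T}\Big((L-l)w_{i,l}^t-\sum_{r=l}^{L}(L-r)\eta_{i,r}^t\phi_{1,r}^t-\sum_{k=l+1}^{L}\phi_{2,k}^t\Big),\qquad 0\le l\le L$$ (in particular $\eta_{i,L}^t=0$). Let $\Gamma(x)=(\tilde w_{i,l}^t,\nabla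 F_i(\tilde w_{i,l}^t))_{i,l,t}$ be the family of the recomputed parameters and gradients, where $$\tilde w_{i,l}^t=\hat w_i^t-\sum_{p=0}^{l-1}\eta_{i,p}^t\,\phi_{1,p}^t .$$ Then $\Gamma$ has a fixed point $x$. At this fixed point the mean-field terms are self-consistent: with the $\phi_1,\phi_2,\eta$ of $x$ one has $\eta_{i,L}^t=0$, $w_{i,0}^t=\hat w_i^t$, $w_{i,l+1}^t=w_{i,l}^t-\eta_{i,l}^t\phi_{1,l}^t$ for $0\le l<L$, the displayed equations for the learning rates, and $$\phi_{1,l}^t=\frac1N\sum_{i=1}^N\nabla F_i(w_{i,l}^t),\qquad \phi_{2,l}^t=\frac1N\sum_{i=1}^N w_{i,l}^t .$$ The same holds if only the onset parameters $\hat w_i^0$ of the first iteration are given, and for $t\ge 1$ the onset parameters are those of the server aggregation, $\hat w_i^{t}=\sum_{j=1}^N \frac{D_j}{\sum_{k=1}^N D_k}\,w_{j,L}^{t-1}$, computed from the argument $x$ of $\Gamma$, with data sizes $D_j>0$. -/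

import Mathlib

namespace FedAgg

/-- The model parameter space `ℝ^d` with its Euclidean structure. -/
abbrev Param (d : ℕ) : Type := EuclideanSpace ℝ (Fin d)

/-- A vector of `ℝ^d` for every global iteration `t ∈ {0, …, T}`, every local epoch
`l ∈ {0, …, L}` and every client `i` (one of `N`); used in the order `t`, `l`, `i`. -/
abbrev Family (N T L d : ℕ) : Type := Fin (T + 1) → Fin (L + 1) → Fin N → Param d

/-- The argument of the map `Γ`: the local parameters (first component) and the local gradients
(second component) of all clients at all epochs of all iterations. -/
abbrev State (N T L d : ℕ) : Type := Family N T L d × Family N T L d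

variable {N T L d : ℕ}

/-- The mean over the clients, at epoch `l` of iteration `t`. -/
noncomputable def clientMean (v : Family N T L d) (t : Fin (T + 1)) (l : Fin (L + 1)) : Param d :=
  (N : ℝ)⁻¹ • ∑ i, v t l i

/-- The mean-field term `φ₁`: the average of the clients' gradients in the state `x`. -/
noncomputable def phi1 (x : State N T L d) : Fin (T + 1) → Fin (L + 1) → Param d :=
  clientMean x.2

/-- The mean-field term `φ₂`: the average of the clients' parameters in the state `x`. -/
noncomputable def phi2 (x : State N T L d) : Fin (T + 1) → Fin (L + 1) → Param d :=
  clientMean x.1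

/-- The equations for the adaptive learning rates `η_0, …, η_L` of one client in one iteration,
given the mean-field terms `φ₁`, `φ₂` and the parameters `w_0, …, w_L` of that client:
`η_l = (1-α)/α · φ₁_lᵀ ((L-l) w_l - ∑_{r=l}^{L} (L-r) η_r φ₁_r - ∑_{k=l+1}^{L} φ₂_k)`. -/
def IsAdaptiveRate (α : ℝ) (φ₁ φ₂ w : Fin (L + 1) → Param d) (η : Fin (L + 1) → ℝ) : Prop :=
  ∀ l : Fin (L + 1), η l = (1 - α) / α * inner ℝ (φ₁ l)
    (((L : ℝ) - (l : ℕ)) • w l - ∑ r ∈ Finset.Ici l, (((L : ℝ) - (r : ℕ)) * η r) • φ₁ r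
      - ∑ k ∈ Finset.Ioi l, φ₂ k)

/-- The solution of these equations by backward recursion: the term `r = l`, which contains the
unknown `η_l`, is brought to the left-hand side, and the `η_r` with `r > l` are known. -/
noncomputable def adaptiveRate (α : ℝ) (φ₁ φ₂ w : Fin (L + 1) → Param d) (l : Fin (L + 1)) : ℝ :=
  (1 - α) / α * inner ℝ (φ₁ l)
    (((L : ℝ) - (l : ℕ)) • w l
      - ∑ r ∈ (Finset.Ioi l).attach,
          (((L : ℝ) - (r.1 : ℕ)) * adaptiveRate α φ₁ φ₂ w r.1) • φ₁ r.1
      - ∑ k ∈ Finset.Ioi l, φ₂ k)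
    / (1 + (1 - α) / α * (((L : ℝ) - (l : ℕ)) * inner ℝ (φ₁ l) (φ₁ l)))
termination_by L - (l : ℕ)
decreasing_by
  have h := r.2
  rw [Finset.mem_Ioi, Fin.lt_def] at h
  have := r.1.2
  omega

theorem adaptiveRate_denom_pos {α : ℝ} (h0 : 0 < α) (h1 : α ≤ 1) (v : Param d)
    (l : Fin (L + 1)) :
    0 < 1 + (1 - α) / α * (((L : ℝ) - (l : ℕ)) * inner ℝ v v) := by
  have hl : ((l : ℕ) : ℝ) ≤ L := by exact_mod_cast Nat.lt_succ_iff.mp l.2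
  have h2 : 0 ≤ (1 - α) / α := div_nonneg (by linarith) h0.le
  have h3 : 0 ≤ inner ℝ v v := real_inner_self_nonneg
  have := mul_nonneg h2 (mul_nonneg (sub_nonneg.mpr hl) h3)
  linarith

/-- For `0 < α ≤ 1` the equations for the adaptive learning rates have exactly one solution,
namely `adaptiveRate`. -/
theorem isAdaptiveRate_iff {α : ℝ} (h0 : 0 < α) (h1 : α ≤ 1)
    (φ₁ φ₂ w : Fin (L + 1) → Param d) (η : Fin (L + 1) → ℝ) :
    IsAdaptiveRate α φ₁ φ₂ w η ↔ η = adaptiveRate α φ₁ φ₂ w := by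
  have key : ∀ (θ : Fin (L + 1) → ℝ) (l : Fin (L + 1)),
      (θ l = (1 - α) / α * inner ℝ (φ₁ l)
        (((L : ℝ) - (l : ℕ)) • w l - ∑ r ∈ Finset.Ici l, (((L : ℝ) - (r : ℕ)) * θ r) • φ₁ r
          - ∑ k ∈ Finset.Ioi l, φ₂ k)) ↔
      θ l = (1 - α) / α * inner ℝ (φ₁ l)
        (((L : ℝ) - (l : ℕ)) • w l - ∑ r ∈ Finset.Ioi l, (((L : ℝ) - (r : ℕ)) * θ r) • φ₁ r
          - ∑ k ∈ Finset.Ioi l, φ₂ k)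
        / (1 + (1 - α) / α * (((L : ℝ) - (l : ℕ)) * inner ℝ (φ₁ l) (φ₁ l))) := by
    intro θ l
    rw [eq_div_iff (adaptiveRate_denom_pos h0 h1 (φ₁ l) l).ne',
      ← Finset.Ioi_insert l, Finset.sum_insert (by simp)]
    simp only [inner_sub_right, inner_add_right, inner_smul_right]
    constructor <;> intro h <;> linear_combination h
  constructor
  · intro h
    have : ∀ (n : ℕ) (l : Fin (L + 1)), L - (l : ℕ) = n → η l = adaptiveRate α φ₁ φ₂ w l := by
      intro n
      induction n using Nat.strong_induction_on with
      | _ n ih =>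
        intro l hl
        rw [(key η l).mp (h l), adaptiveRate,
          Finset.sum_attach (Finset.Ioi l)
            (fun r => (((L : ℝ) - (r : ℕ)) * adaptiveRate α φ₁ φ₂ w r) • φ₁ r)]
        have hs : ∑ r ∈ Finset.Ioi l, (((L : ℝ) - (r : ℕ)) * η r) • φ₁ r
            = ∑ r ∈ Finset.Ioi l, (((L : ℝ) - (r : ℕ)) * adaptiveRate α φ₁ φ₂ w r) • φ₁ r := by
          refine Finset.sum_congr rfl fun r hr => ?_
          rw [Finset.mem_Ioi, Fin.lt_def] at hr
          have := r.2
          rw [ih (L - (r : ℕ)) (by omega) r rfl]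
        rw [hs]
    exact funext fun l => this _ l rfl
  · rintro rfl l
    rw [key]
    conv_lhs => rw [adaptiveRate]
    rw [Finset.sum_attach (Finset.Ioi l)
      (fun r => (((L : ℝ) - (r : ℕ)) * adaptiveRate α φ₁ φ₂ w r) • φ₁ r)]

/-- The learning rates `η_{i,l}^t` of all clients that belong to the state `x`, the mean-field
terms being the averages over `x`. -/
noncomputable def rate (α : ℝ) (x : State N T L d) (t : Fin (T + 1)) (l : Fin (L + 1))
    (i : Fin N) : ℝ :=
  adaptiveRate α (phi1 x t) (phi2 x t) (fun k => x.1 t k i) l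

/-- The recomputed local parameters
`w_{i,0}^t - ∑_{p=0}^{l-1} η_{i,p}^t φ₁_p^t`, for given parameters `start t i = w_{i,0}^t` at
the onset of the iterations. -/
noncomputable def newParam (α : ℝ) (start : Fin (T + 1) → Fin N → Param d)
    (x : State N T L d) : Family N T L d :=
  fun t l i => start t i - ∑ p ∈ Finset.Iio l, rate α x t p i • phi1 x t p

/-- The map `Γ`: it sends the local parameters and gradients of all clients, at all epochs of all
iterations, to the recomputed parameters and to the gradients of the local losses there. -/
noncomputable def Gamma (F : Fin N → Param d → ℝ) (α : ℝ)
    (start : Fin (T + 1) → Fin N → Param d) (x : State N T L d) : State N T L d :=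
  (newParam α start x, fun t l i => gradient (F i) (newParam α start x t l i))

/-- The onset parameters under server aggregation: given ones in iteration `0`, and in iteration
`t + 1`, for all clients, the average of the final local parameters `w_{j,L}^t`, weighted by
the data sizes `D_j`. -/
noncomputable def aggregatedStart (D : Fin N → ℝ) (w₀ : Fin N → Param d) (x : State N T L d) :
    Fin (T + 1) → Fin N → Param d :=
  Fin.cases w₀ fun s _ => ∑ j, (D j / ∑ k, D k) • x.1 s.castSucc (Fin.last L) j

/-- Self-consistency of mean-field terms `φ₁`, `φ₂`: they are the averages of the gradients and of
the parameters of the clients along the very trajectories `w` that the clients follow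
when they use the adaptive learning rates `η` computed from `φ₁`, `φ₂`. -/
structure IsSelfConsistent (F : Fin N → Param d → ℝ) (α : ℝ)
    (start : Fin (T + 1) → Fin N → Param d) (φ₁ φ₂ : Fin (T + 1) → Fin (L + 1) → Param d)
    (w : Family N T L d) (η : Fin (T + 1) → Fin (L + 1) → Fin N → ℝ) : Prop where
  grad_mean : ∀ t l, φ₁ t l = (N : ℝ)⁻¹ • ∑ i, gradient (F i) (w t l i)
  param_mean : ∀ t l, φ₂ t l = (N : ℝ)⁻¹ • ∑ i, w t l i
  rate_last : ∀ t i, η t (Fin.last L) i = 0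
  rate_eq : ∀ t i, IsAdaptiveRate α (φ₁ t) (φ₂ t) (fun l => w t l i) (fun l => η t l i)
  onset : ∀ t i, w t 0 i = start t i
  step : ∀ t (l : Fin L) i, w t l.succ i = w t l.castSucc i - η t l.castSucc i • φ₁ t l.castSucc

end FedAgg

/-! Put `c = (1-α)/α ≥ 0`. Summation by parts turns the learning-rate equation into the feedback law
`η_l = c ⟨φ₁_l, ∑_{k>l} (w_k - φ₂_k)⟩`. A solution is sought with `φ₂` constant, equal to the mean
`m` of the onset parameters. The deviations `v = w - m` then solve a linear system `closedLoop c φ₁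
v = v₀`. This operator is coercive, `⟨v, Kv⟩ = |v|² + c ∑_l ⟨φ₁_l, ∑_{k>l} v_k⟩²`, so `v` exists,
depends continuously on `φ₁`, and is bounded independently of `φ₁`. By linearity the deviations of
all clients sum to zero, so `φ₂ = m` is consistent.

What remains is a fixed point in `φ₁` alone: averaging the gradients along these trajectories is a
continuous map of bounded range, and Brouwer's theorem applies (`exists_feedback_equilibrium`).
Global iterations are solved one after another, which also covers aggregation.

Brouwer's theorem is proved through volumes: `∫ det (1 + t Dg)` is polynomial in `t` and constant
for small `t`, hence constant, whereas a retraction onto the sphere would make it vanish at `t = 1`.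
-/

section Brouwer

/-! ### Brouwer's theorem: determinants of perturbations of the identity. -/

open MeasureTheory Metric Set

/-- `det (1 + tA)` is a polynomial in `t` of degree at most the dimension, so Lagrange interpolation
recovers its value at `1`, with weights independent of `A`. -/
theorem LinearMap.exists_det_id_add_eq_sum {E : Type*} [AddCommGroup E] [Module ℝ E]
    [FiniteDimensional ℝ E] (τ : Fin (Module.finrank ℝ E + 1) → ℝ)
    (hτ : Function.Injective τ) :
    ∃ c : Fin (Module.finrank ℝ E + 1) → ℝ, ∀ A : E →ₗ[ℝ] E,
      LinearMap.det (LinearMap.id + A) = ∑ j, c j * LinearMap.det (LinearMap.id + τ j • A) := by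
  classical
  refine ⟨fun j => (Lagrange.basis Finset.univ τ j).eval 1, fun A => ?_⟩
  set b := Module.finBasis ℝ E
  set M := LinearMap.toMatrix b b A
  set P : Polynomial ℝ := Matrix.det ((Polynomial.X : Polynomial ℝ) • M.map Polynomial.C
    + (1 : Matrix _ _ ℝ).map Polynomial.C)
  have hdeg : P.degree < (Finset.univ : Finset (Fin (Module.finrank ℝ E + 1))).card := by
    refine lt_of_le_of_lt Polynomial.degree_le_natDegree ?_
    have := Polynomial.natDegree_det_X_add_C_le M (1 : Matrix _ _ ℝ)
    simp only [Fintype.card_fin] at this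
    rw [Finset.card_univ, Fintype.card_fin]
    exact_mod_cast Nat.lt_succ_of_le this
  have heval : ∀ t : ℝ, P.eval t = LinearMap.det (LinearMap.id + t • A) := by
    intro t
    rw [← LinearMap.det_toMatrix b, map_add, map_smul, LinearMap.toMatrix_id,
      ← Polynomial.coe_evalRingHom, RingHom.map_det]
    congr 1
    ext i j
    simp only [M, Matrix.map_apply, Matrix.add_apply, Matrix.smul_apply, smul_eq_mul,
      Polynomial.coe_evalRingHom, RingHom.mapMatrix_apply, Polynomial.eval_add,
      Polynomial.eval_mul, Polynomial.eval_X, Polynomial.eval_C]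
    exact add_comm _ _
  have hP := Lagrange.eq_interpolate (s := Finset.univ) (v := τ) hτ.injOn hdeg
  have h1 := congrArg (Polynomial.eval 1) hP
  rw [Lagrange.interpolate_apply, Polynomial.eval_finsetSum, heval, one_smul] at h1
  rw [h1]
  refine Finset.sum_congr rfl fun j _ => ?_
  rw [Polynomial.eval_mul, Polynomial.eval_C, heval, mul_comm]

/-- Along `1 + sA`, `0 ≤ s ≤ 1`, the Neumann series keeps the determinant nonzero, and it starts at
`1`. -/
theorem ContinuousLinearMap.det_one_add_pos {E : Type*} [NormedAddCommGroup E] [NormedSpace ℝ E]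
    [FiniteDimensional ℝ E] (A : E →L[ℝ] E) (hA : ‖A‖ < 1) : 0 < (1 + A).det := by
  have : CompleteSpace E := FiniteDimensional.complete ℝ E
  have hne : ∀ s ∈ Icc (0 : ℝ) 1, (1 + s • A).det ≠ 0 := by
    intro s hs
    have h1 : ‖-(s • A)‖ < 1 := by
      rw [norm_neg, norm_smul, Real.norm_of_nonneg hs.1]
      nlinarith [norm_nonneg A, hs.2]
    have hu : IsUnit (1 + s • A) := by
      simpa using isUnit_one_sub_of_norm_lt_one h1
    have := (hu.map (ContinuousLinearMap.toLinearMapRingHom : (E →L[ℝ] E) →+* (E →ₗ[ℝ] E))).map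
      (LinearMap.det : (E →ₗ[ℝ] E) →* ℝ)
    exact this.ne_zero
  have hc : ContinuousOn (fun s : ℝ => (1 + s • A).det) (Icc 0 1) :=
    (ContinuousLinearMap.continuous_det.comp (by fun_prop)).continuousOn
  by_contra hneg
  have hmem : (0 : ℝ) ∈ Icc ((1 + (1 : ℝ) • A).det) ((1 + (0 : ℝ) • A).det) := by
    refine ⟨by simpa using not_lt.mp hneg, ?_⟩
    simp [ContinuousLinearMap.det]
  obtain ⟨s, hs, h0⟩ := intermediate_value_Icc' zero_le_one hc hmem
  exact hne s hs h0

/-! ### Volume of a ball under perturbations of the identity. -/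

section Volume

variable {E : Type*} [NormedAddCommGroup E] [NormedSpace ℝ E] [FiniteDimensional ℝ E]
  {g : E → E} {C : NNReal} {R : ℝ}

theorem LipschitzWith.bijective_add_smul (hg : LipschitzWith C g) {t : ℝ} (ht : 0 ≤ t)
    (htC : t * C < 1) : Function.Bijective fun x => x + t • g x := by
  have : CompleteSpace E := FiniteDimensional.complete ℝ E
  lift t to NNReal using ht
  have ht : (0 : ℝ) ≤ t := t.2
  constructor
  · intro x y hxy
    have h1 : x - y = (t : ℝ) • (g y - g x) := by
      rw [smul_sub, sub_eq_sub_iff_add_eq_add]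
      simpa [add_comm] using hxy
    have h2 : ‖x - y‖ ≤ t * C * ‖x - y‖ := by
      calc ‖x - y‖ = t * ‖g y - g x‖ := by rw [h1, norm_smul, Real.norm_of_nonneg ht]
        _ ≤ t * (C * ‖y - x‖) := by gcongr; simpa [dist_eq_norm] using hg.dist_le_mul y x
        _ = _ := by rw [norm_sub_rev y x]; ring
    have h3 : ‖x - y‖ = 0 := by nlinarith [norm_nonneg (x - y)]
    exact sub_eq_zero.mp (norm_eq_zero.mp h3)
  · intro y
    have hc : ContractingWith (t * C) fun x => y - (t : ℝ) • g x := by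
      refine ⟨by exact_mod_cast htC, LipschitzWith.of_dist_le_mul fun u v => ?_⟩
      rw [dist_sub_left, dist_smul₀, Real.norm_of_nonneg ht]
      calc (t : ℝ) * dist (g u) (g v) ≤ t * (C * dist u v) := by gcongr; exact hg.dist_le_mul u v
        _ = _ := by push_cast; ring
    obtain ⟨x, hx, -⟩ := hc.exists_fixedPoint 0 (edist_ne_top _ _)
    exact ⟨x, by rw [← eq_sub_iff_add_eq]; exact hx.symm⟩

variable [MeasurableSpace E] [BorelSpace E] (μ : Measure E) [μ.IsAddHaarMeasure]

/-- For small `t`, `x + t g x` is a bijection fixing every point outside the ball, so it maps the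
ball onto itself; change of variables applies with a positive Jacobian. -/
theorem LipschitzWith.setIntegral_ball_det_small (hg : LipschitzWith C g)
    (h0 : ∀ x, R ≤ ‖x‖ → g x = 0) (hd : ∀ x ∈ ball (0 : E) R, DifferentiableAt ℝ g x)
    {t : ℝ} (ht : 0 ≤ t) (htC : t * C < 1) :
    ∫ x in ball (0 : E) R, (1 + t • fderiv ℝ g x).det ∂μ = μ.real (ball 0 R) := by
  have hbij := hg.bijective_add_smul ht htC
  have himg : (fun x => x + t • g x) '' ball 0 R = ball 0 R := by
    have hcompl : (fun x => x + t • g x) '' (ball 0 R)ᶜ = (ball 0 R)ᶜ := by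
      refine (Set.image_congr fun x hx => ?_).trans (Set.image_id _)
      rw [h0 x (by simpa using hx)]
      simp
    rw [← compl_inj_iff, ← Set.image_compl_eq hbij, hcompl]
  have hder : ∀ x ∈ ball (0 : E) R, HasFDerivWithinAt (fun x => x + t • g x)
      (1 + t • fderiv ℝ g x) (ball 0 R) x := fun x hx =>
    ((hasFDerivAt_id x).add ((hd x hx).hasFDerivAt.const_smul t)).hasFDerivWithinAt
  have key := integral_image_eq_integral_abs_det_fderiv_smul μ measurableSet_ball hder
    hbij.1.injOn (fun _ => (1 : ℝ))
  rw [himg] at key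
  simp only [smul_eq_mul, mul_one, integral_const, MeasurableSet.univ, measureReal_restrict_apply,
    Set.univ_inter] at key
  rw [key]
  refine integral_congr_ae (Filter.Eventually.of_forall fun x => ?_)
  refine (abs_of_pos (ContinuousLinearMap.det_one_add_pos _ ?_)).symm
  rw [norm_smul, Real.norm_of_nonneg ht]
  exact lt_of_le_of_lt (by gcongr; exact norm_fderiv_le_of_lipschitz ℝ hg) htC

theorem LipschitzWith.integrableOn_ball_det (hg : LipschitzWith C g) (t : ℝ) :
    IntegrableOn (fun x => (1 + t • fderiv ℝ g x).det) (ball 0 R) μ := by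
  have : CompleteSpace E := FiniteDimensional.complete ℝ E
  have hK : IsCompact (closedBall (0 : E →L[ℝ] E) C) := isCompact_closedBall _ _
  have hcont : Continuous fun A : E →L[ℝ] E => (1 + t • A).det :=
    ContinuousLinearMap.continuous_det.comp (by fun_prop)
  obtain ⟨B, hB⟩ := hK.exists_bound_of_continuousOn hcont.continuousOn
  refine Measure.integrableOn_of_bounded (M := B) measure_ball_lt_top.ne ?_ ?_
  · exact (hcont.measurable.comp (measurable_fderiv ℝ g)).aestronglyMeasurable
  · refine Filter.Eventually.of_forall fun x => hB _ ?_
    simpa using norm_fderiv_le_of_lipschitz ℝ hg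

theorem LipschitzWith.setIntegral_ball_det (hg : LipschitzWith C g)
    (h0 : ∀ x, R ≤ ‖x‖ → g x = 0) (hd : ∀ x ∈ ball (0 : E) R, DifferentiableAt ℝ g x) :
    ∫ x in ball (0 : E) R, (1 + fderiv ℝ g x).det ∂μ = μ.real (ball 0 R) := by
  set n := Module.finrank ℝ E
  -- Distinct nodes with `τ j * C < 1`, where the small-parameter case applies.
  set τ : Fin (n + 1) → ℝ := fun j => (j : ℝ) / ((n + 1) * (C + 1))
  have hC : (0 : ℝ) ≤ C := C.2
  have hτ : Function.Injective τ := by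
    intro i j hij
    have : ((n : ℝ) + 1) * (C + 1) ≠ 0 := by positivity
    simp only [τ, div_left_inj' this] at hij
    exact Fin.ext (by exact_mod_cast hij)
  obtain ⟨c, hc⟩ := LinearMap.exists_det_id_add_eq_sum τ hτ
  have hc' : ∀ A : E →L[ℝ] E, (1 + A).det = ∑ j, c j * (1 + τ j • A).det := fun A => hc A
  -- The case `A = 0`.
  have hsum : ∑ j, c j = 1 := by
    have := hc 0
    rw [add_zero, LinearMap.det_id] at this
    rw [this]
    refine Finset.sum_congr rfl fun j _ => ?_
    rw [smul_zero, add_zero, LinearMap.det_id, mul_one]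
  rw [integral_congr_ae (Filter.Eventually.of_forall fun x => hc' (fderiv ℝ g x)),
    integral_finsetSum _ fun j _ => (hg.integrableOn_ball_det μ (τ j)).const_mul (c j)]
  simp_rw [integral_const_mul]
  rw [← one_mul (μ.real _), ← hsum, Finset.sum_mul]
  refine Finset.sum_congr rfl fun j _ => ?_
  rw [hg.setIntegral_ball_det_small μ h0 hd (by positivity)]
  have hj : (j : ℝ) < n + 1 := by exact_mod_cast j.2
  rw [div_mul_eq_mul_div, div_lt_one (by positivity)]
  nlinarith [hC, (Nat.cast_nonneg (j : ℕ) : (0 : ℝ) ≤ (j : ℕ))]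

end Volume

/-! ### From the no-retraction theorem to fixed points. -/

section Retraction

variable {E : Type*} [NormedAddCommGroup E]

theorem exists_dist_le_norm_eq [NormedSpace ℝ E] {R : ℝ} {x y : E} (hx : ‖x‖ ≤ R) (hy : R ≤ ‖y‖) :
    ∃ z, ‖z‖ = R ∧ dist x z ≤ dist x y := by
  have hc : ContinuousOn (fun s : ℝ => ‖AffineMap.lineMap x y s‖) (Icc 0 1) :=
    (AffineMap.lineMap_continuous.norm).continuousOn
  obtain ⟨s, hs, h⟩ := intermediate_value_Icc zero_le_one hc
    (show R ∈ Icc _ _ by simpa using ⟨hx, hy⟩)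
  refine ⟨_, h, ?_⟩
  rw [dist_left_lineMap, Real.norm_of_nonneg hs.1]
  exact mul_le_of_le_one_left dist_nonneg hs.2

/-- A segment leaving the ball crosses the sphere, where `g` vanishes, so extension by zero keeps
the constant. -/
theorem LipschitzOnWith.lipschitzWith_indicator_closedBall [NormedSpace ℝ E] {F : Type*}
    [NormedAddCommGroup F] {g : E → F} {C : NNReal} {R : ℝ}
    (hg : LipschitzOnWith C g (closedBall 0 R)) (h0 : ∀ x, ‖x‖ = R → g x = 0) :
    LipschitzWith C ((closedBall (0 : E) R).indicator g) := by
  have key : ∀ x y : E, ‖x‖ ≤ R → ¬ ‖y‖ ≤ R → dist (g x) 0 ≤ C * dist x y := by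
    intro x y hx hy
    obtain ⟨z, hz, hd⟩ := exists_dist_le_norm_eq hx (not_le.mp hy).le
    rw [← h0 z hz]
    refine (hg.dist_le_mul x (by simpa using hx) z (by simpa using hz.le)).trans ?_
    gcongr
  refine LipschitzWith.of_dist_le_mul fun x y => ?_
  by_cases hx : ‖x‖ ≤ R <;> by_cases hy : ‖y‖ ≤ R
  · rw [indicator_of_mem (by simpa using hx), indicator_of_mem (by simpa using hy)]
    exact hg.dist_le_mul x (by simpa using hx) y (by simpa using hy)
  · rw [indicator_of_mem (by simpa using hx), indicator_of_notMem (by simpa using hy)]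
    exact key x y hx hy
  · rw [indicator_of_notMem (by simpa using hx), indicator_of_mem (by simpa using hy),
      dist_comm, dist_comm x]
    exact key y x hy hx
  · rw [indicator_of_notMem (by simpa using hx), indicator_of_notMem (by simpa using hy), dist_self]
    positivity

variable [InnerProductSpace ℝ E] [FiniteDimensional ℝ E]

/-- There is no continuously differentiable retraction of a ball onto its boundary sphere. -/
theorem ContDiff.false_of_retraction_sphere {f : E → E} {R : ℝ} (hR : 0 < R)
    (hf : ContDiff ℝ 1 f) (hnorm : ∀ x, ‖x‖ ≤ R → ‖f x‖ = R) (hid : ∀ x, ‖x‖ = R → f x = x) :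
    False := by
  borelize E
  obtain ⟨C, hC⟩ := (hf.sub contDiff_id).contDiffOn.exists_lipschitzOnWith one_ne_zero
    (convex_closedBall (0 : E) R) (isCompact_closedBall 0 R)
  have hlip := hC.lipschitzWith_indicator_closedBall fun x hx => by simp [hid x hx]
  set g := (closedBall (0 : E) R).indicator fun x => f x - id x
  have hgf : ∀ x ∈ ball (0 : E) R, HasFDerivAt g (fderiv ℝ f x - ContinuousLinearMap.id ℝ E) x := by
    intro x hx
    refine ((hf.differentiable one_ne_zero x).hasFDerivAt.sub (hasFDerivAt_id x)).congr_of_eventuallyEq ?_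
    filter_upwards [isOpen_ball.mem_nhds hx] with y hy
    exact indicator_of_mem (ball_subset_closedBall hy) _
  have hvol := hlip.setIntegral_ball_det (R := R) (Measure.addHaar (G := E)) (fun x hx => by
    by_cases hx' : ‖x‖ ≤ R
    · refine (indicator_of_mem (by simpa using hx') _).trans ?_
      simp [hid x (le_antisymm hx' hx)]
    · exact indicator_of_notMem (by simpa using hx') _) fun x hx => (hgf x hx).differentiableAt
  have hdet : ∀ x ∈ ball (0 : E) R, (1 + fderiv ℝ g x).det = 0 := by
    intro x hx
    rw [(hgf x hx).fderiv]
    have h1 : (1 : E →L[ℝ] E) + (fderiv ℝ f x - ContinuousLinearMap.id ℝ E) = fderiv ℝ f x :=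
      add_sub_cancel _ _
    rw [h1]
    -- `‖f‖²` is constant on the ball, so the nonzero vector `f x` is orthogonal to the range of the
    -- derivative, which is therefore singular.
    have horth : ∀ v, Inner.inner ℝ (f x) (fderiv ℝ f x v) = 0 := by
      intro v
      have hd := (hf.differentiable one_ne_zero x).hasFDerivAt.norm_sq
      have hconst : HasFDerivAt (fun y => ‖f y‖ ^ 2) (0 : E →L[ℝ] ℝ) x := by
        refine (hasFDerivAt_const (R ^ 2) x).congr_of_eventuallyEq ?_
        filter_upwards [isOpen_ball.mem_nhds hx] with y hy
        rw [hnorm y (by simpa using (ball_subset_closedBall hy))]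
      have := congrArg (fun A : E →L[ℝ] ℝ => A v) (hd.unique hconst)
      simpa using this
    by_contra hne
    have hsurj : Function.Surjective (fderiv ℝ f x) :=
      ((LinearMap.equivOfDetNeZero _ hne).surjective)
    obtain ⟨v, hv⟩ := hsurj (f x)
    have h2 := horth v
    rw [hv, real_inner_self_eq_norm_sq, hnorm x (by simpa using ball_subset_closedBall hx)] at h2
    exact (pow_pos hR 2).ne' h2
  rw [setIntegral_congr_fun measurableSet_ball hdet] at hvol
  have hpos : 0 < (Measure.addHaar (G := E)).real (ball 0 R) :=
    ENNReal.toReal_pos (measure_ball_pos _ _ hR).ne' measure_ball_lt_top.ne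
  simp at hvol
  exact hpos.ne hvol

theorem ContDiff.exists_eq_zero_of_eq_id {F : E → E} {R : ℝ} (hR : 0 < R) (hF : ContDiff ℝ 1 F)
    (hid : ∀ x, R ≤ ‖x‖ → F x = x) : ∃ x, F x = 0 := by
  by_contra! hne
  refine ContDiff.false_of_retraction_sphere hR (f := fun x => (R / ‖F x‖) • F x)
    ((contDiff_const.div (hF.norm ℝ hne) fun x => norm_ne_zero_iff.mpr (hne x)).smul hF) ?_ ?_
  · intro x _
    rw [norm_smul, norm_div, norm_norm, Real.norm_of_nonneg hR.le,
      div_mul_cancel₀ _ (norm_ne_zero_iff.mpr (hne x))]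
  · intro x hx
    rw [hid x hx.ge, hx, div_self hR.ne', one_smul]

theorem Continuous.exists_eq_zero_of_eq_id {F : E → E} {R : ℝ} (hR : 0 < R) (hF : Continuous F)
    (hid : ∀ x, R ≤ ‖x‖ → F x = x) : ∃ x, F x = 0 := by
  by_contra! hne
  have hcomp : IsCompact (closedBall (0 : E) R) := isCompact_closedBall 0 R
  obtain ⟨x₀, -, hx₀⟩ := hcomp.exists_isMinOn ⟨0, by simpa using hR.le⟩ hF.norm.continuousOn
  set δ := min ‖F x₀‖ R
  have hδ : 0 < δ := lt_min (norm_pos_iff.mpr (hne x₀)) hR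
  have hlow : ∀ x, δ ≤ ‖F x‖ := by
    intro x
    rcases le_total ‖x‖ R with hx | hx
    · exact (min_le_left _ _).trans (hx₀ (by simpa using hx))
    · rw [hid x hx]
      exact (min_le_right _ _).trans hx
  have hg : Continuous fun x => F x - x := hF.sub continuous_id
  have hsupp : HasCompactSupport fun x => F x - x :=
    HasCompactSupport.intro hcomp fun x hx => by
      rw [hid x (by simpa using (not_le.mp (by simpa using hx)).le), sub_self]
  obtain ⟨ε, hε, hunif⟩ := Metric.uniformContinuous_iff.mp
    (hg.uniformContinuous_of_tendsto_cocompact hsupp.is_zero_at_infty) (δ / 2) (half_pos hδ)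
  -- `G` smooths `F - id` at scale `ε`: it is `δ / 2`-close everywhere and exactly zero beyond
  -- radius `R + ε`, where `F - id` vanishes on whole `ε`-balls.
  obtain ⟨G, hG, happrox⟩ := hg.exists_contDiff_dist_le_of_forall_mem_ball_dist_le hε
  obtain ⟨x, hx⟩ := ContDiff.exists_eq_zero_of_eq_id (F := fun x => x + G x) (R := R + ε)
    (by positivity) (contDiff_id.add (hG.of_le (by exact_mod_cast le_top))) (by
      intro x hx
      have hzero : ∀ y ∈ ball x ε, F y - y = 0 := by
        intro y hy
        rw [hid, sub_self]
        have := norm_sub_norm_le x y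
        rw [mem_ball, dist_comm, dist_eq_norm] at hy
        linarith
      have := happrox x 0 fun y hy => by
        rw [hzero y hy, hzero x (mem_ball_self hε), dist_self]
      rw [hzero x (mem_ball_self hε), dist_zero_right] at this
      simpa using this)
  have h1 := happrox x (δ / 2) fun y hy => (hunif hy).le
  have h2 : ‖F x‖ ≤ δ / 2 := by
    rw [dist_comm, dist_eq_norm] at h1
    rw [add_eq_zero_iff_eq_neg'.mp hx] at h1
    simpa using h1
  linarith [hlow x]

end Retraction

theorem Continuous.exists_fixedPoint_of_norm_le_of_inner {E : Type*} [NormedAddCommGroup E]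
    [InnerProductSpace ℝ E] [FiniteDimensional ℝ E] {h : E → E} (hh : Continuous h) {R : ℝ}
    (hb : ∀ x, ‖h x‖ ≤ R) : ∃ x, h x = x := by
  have hR : 0 ≤ R := (norm_nonneg _).trans (hb 0)
  obtain ⟨x, hx⟩ := Continuous.exists_eq_zero_of_eq_id (R := R + 1) (by positivity)
    -- The cutoff is `1` for `‖x‖ ≤ R` and `0` beyond `R + 1`; any zero has norm at most `R`, where
    -- the cutoff is inactive.
    (F := fun x => x - (max 0 (min 1 (R + 1 - ‖x‖)) : ℝ) • h x) (by fun_prop) (by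
      intro x hx
      rw [max_eq_left ((min_le_right _ _).trans (by linarith)), zero_smul, sub_zero])
  have hx' := sub_eq_zero.mp hx
  have hle : ‖x‖ ≤ R := by
    rw [hx', norm_smul, Real.norm_of_nonneg (le_max_left _ _)]
    calc _ ≤ 1 * ‖h x‖ := by gcongr; exact max_le zero_le_one (min_le_left _ _)
      _ ≤ R := by rw [one_mul]; exact hb x
  rw [min_eq_left (by linarith), max_eq_right zero_le_one, one_smul] at hx'
  exact ⟨x, hx'.symm⟩

/-- **Brouwer's fixed point theorem**, for a continuous self-map of bounded range of a
finite-dimensional space. -/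
theorem Continuous.exists_fixedPoint_of_norm_le {E : Type*} [NormedAddCommGroup E]
    [NormedSpace ℝ E] [FiniteDimensional ℝ E] {h : E → E} (hh : Continuous h) {R : ℝ}
    (hb : ∀ x, ‖h x‖ ≤ R) : ∃ x, h x = x := by
  set e : E ≃L[ℝ] EuclideanSpace ℝ (Fin (Module.finrank ℝ E)) := toEuclidean
  obtain ⟨y, hy⟩ := Continuous.exists_fixedPoint_of_norm_le_of_inner
    (h := fun y => e (h (e.symm y))) (by fun_prop) (R := ‖e.toContinuousLinearMap‖ * R) fun y =>
      (e.toContinuousLinearMap.le_opNorm _).trans (mul_le_mul_of_nonneg_left (hb _) (norm_nonneg _))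
  exact ⟨e.symm y, e.injective (by simpa using hy)⟩

end Brouwer

/-- Summation by parts along a trajectory with increments `-u`. -/
theorem sum_Ioi_of_eq_sub_sum_Iio {E : Type*} [AddCommGroup E] [Module ℝ E] {L : ℕ}
    {w u : Fin (L + 1) → E} {w₀ : E}
    (hw : ∀ l, w l = w₀ - ∑ p ∈ Finset.Iio l, u p) (l : Fin (L + 1)) :
    ∑ k ∈ Finset.Ioi l, w k = ((L : ℝ) - (l : ℕ)) • w l
      - ∑ r ∈ Finset.Ici l, ((L : ℝ) - (r : ℕ)) • u r := by
  have hcard : ∀ r : Fin (L + 1), ((Finset.Ioi r).card : ℝ) = (L : ℝ) - (r : ℕ) := by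
    intro r
    rw [Fin.card_Ioi, Nat.add_sub_cancel, Nat.cast_sub (Nat.lt_succ_iff.mp r.2)]
  have hstep : ∀ k ∈ Finset.Ioi l, w k = w l - ∑ p ∈ Finset.Ico l k, u p := by
    intro k hk
    have hlk := (Finset.mem_Ioi.mp hk).le
    have hdisj : Disjoint (Finset.Iio l) (Finset.Ico l k) :=
      Finset.disjoint_left.mpr fun x hx hx' =>
        not_lt.mpr (Finset.mem_Ico.mp hx').1 (Finset.mem_Iio.mp hx)
    have hunion : Finset.Iio k = Finset.Iio l ∪ Finset.Ico l k := by
      ext x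
      simp only [Finset.mem_Iio, Finset.mem_union, Finset.mem_Ico]
      constructor
      · intro h
        exact (lt_or_ge x l).imp id fun h' => ⟨h', h⟩
      · rintro (h | h)
        exacts [h.trans_le hlk, h.2]
    rw [hw k, hw l, hunion, Finset.sum_union hdisj]
    abel
  rw [Finset.sum_congr rfl hstep, Finset.sum_sub_distrib, Finset.sum_const,
    ← Nat.cast_smul_eq_nsmul ℝ, hcard,
    -- After the swap, each increment `u p` with `p ≥ l` is counted once per `k > p`, that is `L -
    -- p` times.
    Finset.sum_comm' (t' := Finset.Ici l) (s' := fun p => Finset.Ioi p) (by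
      intro k p
      simp only [Finset.mem_Ioi, Finset.mem_Ico, Finset.mem_Ici]
      exact ⟨fun h => ⟨h.2.2, h.2.1⟩, fun h => ⟨h.2.trans_lt h.1, h.2, h.1⟩⟩)]
  congr 1
  refine Finset.sum_congr rfl fun p _ => ?_
  rw [Finset.sum_const, ← Nat.cast_smul_eq_nsmul ℝ, hcard]

/-! ### The linear feedback system and its equilibrium. -/

section MeanField

variable {E : Type*} [NormedAddCommGroup E] [InnerProductSpace ℝ E] [FiniteDimensional ℝ E]
  {L : ℕ}

/-- The gain `c ⟨φ_l, ∑_{k>l} v_k⟩` of the feedback law along a trajectory `v`. -/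
noncomputable def feedbackRate (c : ℝ) (φ v : Fin (L + 1) → E) (l : Fin (L + 1)) : ℝ :=
  c * inner ℝ (φ l) (∑ k ∈ Finset.Ioi l, v k)

/-- The operator `v ↦ (v_k + ∑_{l<k} c ⟨φ_l, ∑_{j>l} v_j⟩ φ_l)_k`, which recovers the (constant)
initial value of a trajectory `v` that follows the feedback law. -/
noncomputable def closedLoop (c : ℝ) (φ : Fin (L + 1) → E) :
    (Fin (L + 1) → E) →L[ℝ] (Fin (L + 1) → E) :=
  LinearMap.toContinuousLinearMap
    { toFun := fun v k => v k + ∑ l ∈ Finset.Iio k, feedbackRate c φ v l • φ l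
      map_add' := fun u v => by
        ext1 k
        simp only [feedbackRate, Pi.add_apply, Finset.sum_add_distrib, inner_add_right, mul_add,
          add_smul]
        abel
      map_smul' := fun a v => by
        ext1 k
        simp only [feedbackRate, Pi.smul_apply, ← Finset.smul_sum, inner_smul_right,
          RingHom.id_apply, smul_add, Finset.smul_sum (r := a) (s := Finset.Iio k), smul_smul]
        simp only [mul_left_comm] }

theorem closedLoop_apply (c : ℝ) (φ v : Fin (L + 1) → E) (k : Fin (L + 1)) :
    closedLoop c φ v k = v k + ∑ l ∈ Finset.Iio k, feedbackRate c φ v l • φ l := rfl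

theorem continuous_closedLoop (c : ℝ) :
    Continuous (closedLoop c : (Fin (L + 1) → E) → _) := by
  rw [continuous_clm_apply]
  intro v
  refine continuous_pi fun k => ?_
  simp only [closedLoop_apply, feedbackRate]
  fun_prop

/-- Coercivity: exchanging the sums turns the feedback term into `c` times a sum of squares. -/
theorem sum_norm_sq_le_sum_inner_closedLoop {c : ℝ} (hc : 0 ≤ c) (φ v : Fin (L + 1) → E) :
    ∑ k, ‖v k‖ ^ 2 ≤ ∑ k, inner ℝ (v k) (closedLoop c φ v k) := by
  have h : ∑ k, inner ℝ (v k) (∑ l ∈ Finset.Iio k, feedbackRate c φ v l • φ l)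
      = ∑ l, c * inner ℝ (φ l) (∑ k ∈ Finset.Ioi l, v k) ^ 2 := by
    simp only [inner_sum, inner_smul_right]
    rw [Finset.sum_comm' (t' := Finset.univ) (s' := fun l => Finset.Ioi l) (by simp)]
    refine Finset.sum_congr rfl fun l _ => ?_
    rw [← Finset.mul_sum, ← inner_sum, feedbackRate]
    simp_rw [real_inner_comm (φ l)]
    rw [← inner_sum]
    ring
  simp only [closedLoop_apply, inner_add_right, Finset.sum_add_distrib,
    real_inner_self_eq_norm_sq, h]
  have : 0 ≤ ∑ l, c * inner ℝ (φ l) (∑ k ∈ Finset.Ioi l, v k) ^ 2 :=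
    Finset.sum_nonneg fun l _ => by positivity
  linarith

theorem isUnit_closedLoop {c : ℝ} (hc : 0 ≤ c) (φ : Fin (L + 1) → E) :
    IsUnit (closedLoop c φ) := by
  have hinj : Function.Injective (closedLoop c φ) := by
    rw [injective_iff_map_eq_zero]
    intro v hv
    have h := sum_norm_sq_le_sum_inner_closedLoop hc φ v
    simp only [hv, Pi.zero_apply, inner_zero_right, Finset.sum_const_zero] at h
    have h0 := (Finset.sum_eq_zero_iff_of_nonneg fun k _ => by positivity).mp
      (le_antisymm h (Finset.sum_nonneg fun k _ => by positivity))
    ext1 k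
    simpa using h0 k (Finset.mem_univ k)
  have : CompleteSpace E := FiniteDimensional.complete ℝ E
  rw [ContinuousLinearMap.isUnit_iff_bijective]
  exact ⟨hinj, LinearMap.injective_iff_surjective.mp hinj⟩

/-- The trajectory with initial value `v₀` under the feedback law. -/
noncomputable def feedbackTrajectory (c : ℝ) (φ : Fin (L + 1) → E) (v₀ : E) : Fin (L + 1) → E :=
  Ring.inverse (closedLoop c φ) fun _ => v₀

theorem closedLoop_feedbackTrajectory {c : ℝ} (hc : 0 ≤ c) (φ : Fin (L + 1) → E) (v₀ : E) :
    closedLoop c φ (feedbackTrajectory c φ v₀) = fun _ => v₀ := by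
  have h := Ring.mul_inverse_cancel _ (isUnit_closedLoop hc φ)
  exact congrArg (fun A : (Fin (L + 1) → E) →L[ℝ] (Fin (L + 1) → E) => A fun _ => v₀) h

theorem continuous_feedbackTrajectory {c : ℝ} (hc : 0 ≤ c) (v₀ : E) :
    Continuous fun φ : Fin (L + 1) → E => feedbackTrajectory c φ v₀ := by
  have : CompleteSpace E := FiniteDimensional.complete ℝ E
  have h : Continuous fun φ : Fin (L + 1) → E => Ring.inverse (closedLoop c φ) := by
    rw [continuous_iff_continuousAt]
    intro φ
    obtain ⟨u, hu⟩ := isUnit_closedLoop hc φ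
    have := NormedRing.inverse_continuousAt
      (R := (Fin (L + 1) → E) →L[ℝ] (Fin (L + 1) → E)) u
    rw [hu] at this
    exact ContinuousAt.comp (f := closedLoop c) this (continuous_closedLoop c).continuousAt
  exact h.clm_apply continuous_const

/-- Coercivity and Young's inequality; the point is that the bound does not involve `φ`. -/
theorem sum_norm_sq_feedbackTrajectory_le {c : ℝ} (hc : 0 ≤ c) (φ : Fin (L + 1) → E) (v₀ : E) :
    ∑ k, ‖feedbackTrajectory c φ v₀ k‖ ^ 2 ≤ (L + 1) * ‖v₀‖ ^ 2 := by
  have h := sum_norm_sq_le_sum_inner_closedLoop hc φ (feedbackTrajectory c φ v₀)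
  rw [closedLoop_feedbackTrajectory hc] at h
  have h2 : ∑ k, inner ℝ (feedbackTrajectory c φ v₀ k) v₀
      ≤ ∑ k, (‖feedbackTrajectory c φ v₀ k‖ ^ 2 / 2 + ‖v₀‖ ^ 2 / 2) :=
    Finset.sum_le_sum fun k _ => by
      have := real_inner_le_norm (feedbackTrajectory c φ v₀ k) v₀
      nlinarith [sq_nonneg (‖feedbackTrajectory c φ v₀ k‖ - ‖v₀‖)]
  rw [Finset.sum_add_distrib, ← Finset.sum_div] at h2
  simp only [Finset.sum_const, Finset.card_univ, Fintype.card_fin, nsmul_eq_mul] at h2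
  push_cast at h2
  linarith

theorem norm_feedbackTrajectory_le {c : ℝ} (hc : 0 ≤ c) (φ : Fin (L + 1) → E) (v₀ : E)
    (k : Fin (L + 1)) : ‖feedbackTrajectory c φ v₀ k‖ ≤ (L + 1) * ‖v₀‖ := by
  refine abs_le_of_sq_le_sq' ?_ (by positivity) |>.2
  calc ‖feedbackTrajectory c φ v₀ k‖ ^ 2 ≤ ∑ k, ‖feedbackTrajectory c φ v₀ k‖ ^ 2 :=
        Finset.single_le_sum (f := fun k => ‖feedbackTrajectory c φ v₀ k‖ ^ 2)
          (fun k _ => by positivity) (Finset.mem_univ k)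
    _ ≤ (L + 1) * ‖v₀‖ ^ 2 := sum_norm_sq_feedbackTrajectory_le hc φ v₀
    _ ≤ ((L + 1) * ‖v₀‖) ^ 2 := by
      have : (0 : ℝ) ≤ L := Nat.cast_nonneg L
      nlinarith [mul_nonneg this (sq_nonneg ‖v₀‖), mul_nonneg (mul_nonneg this this) (sq_nonneg ‖v₀‖)]

/-- Linearity in the initial value; this is what keeps the parameter mean constant over the epochs.
-/
theorem sum_feedbackTrajectory_eq_zero {ι : Type*} [Fintype ι] (c : ℝ) (φ : Fin (L + 1) → E)
    {v₀ : ι → E} (h : ∑ i, v₀ i = 0) : ∑ i, feedbackTrajectory c φ (v₀ i) = 0 := by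
  simp only [feedbackTrajectory, ← map_sum]
  have : ∑ i, (fun _ : Fin (L + 1) => v₀ i) = 0 := by
    ext1 k
    simpa using h
  rw [this, map_zero]

/-- Existence of a mean-field equilibrium: the mean `φ` of `G i` along the trajectories that
follow the feedback law determined by `φ` itself. -/
theorem exists_feedback_equilibrium {ι : Type*} [Fintype ι] {c : ℝ} (hc : 0 ≤ c) (a : ℝ) (m : E)
    (v₀ : ι → E) {G : ι → E → E} (hG : ∀ i, Continuous (G i)) :
    ∃ φ : Fin (L + 1) → E, ∀ l, φ l = a • ∑ i, G i (m + feedbackTrajectory c φ (v₀ i) l) := by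
  have : ProperSpace E := FiniteDimensional.proper_real E
  have hbound : ∀ i, ∃ B, ∀ u : E, ‖u‖ ≤ (L + 1) * ‖v₀ i‖ → ‖G i (m + u)‖ ≤ B := by
    intro i
    obtain ⟨B, hB⟩ := (isCompact_closedBall (0 : E) ((L + 1) * ‖v₀ i‖)).exists_bound_of_continuousOn
      (f := fun u => G i (m + u)) (by have := hG i; fun_prop)
    exact ⟨B, fun u hu => hB u (by simpa using hu)⟩
  choose B hB using hbound
  have hcont : Continuous fun (φ : Fin (L + 1) → E) (l : Fin (L + 1)) =>
      a • ∑ i, G i (m + feedbackTrajectory c φ (v₀ i) l) := by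
    refine continuous_pi fun l => (continuous_finsetSum _ fun i _ => ?_).const_smul a
    exact (hG i).comp (continuous_const.add
      ((continuous_apply l).comp (continuous_feedbackTrajectory hc (v₀ i))))
  obtain ⟨φ, hφ⟩ := hcont.exists_fixedPoint_of_norm_le (R := |a| * ∑ i, B i) fun φ => by
    have key : ∀ l : Fin (L + 1), ‖a • ∑ i, G i (m + feedbackTrajectory c φ (v₀ i) l)‖
        ≤ |a| * ∑ i, B i := by
      intro l
      rw [norm_smul, Real.norm_eq_abs]
      gcongr
      exact norm_sum_le_of_le _ fun i _ => hB i _ (norm_feedbackTrajectory_le hc φ _ l)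
    exact (pi_norm_le_iff_of_nonneg ((norm_nonneg _).trans (key 0))).mpr key
  exact ⟨φ, fun l => (congrFun hφ l).symm⟩

end MeanField

/-! ### Solving one global iteration, then all of them. -/

namespace FedAgg

variable {N T L d : ℕ}

/-- The trajectories of all clients in one iteration with onset parameters `w₀` are the ones
produced by the learning rates that are computed from these trajectories. -/
def IsIterationSolution (G : Fin N → Param d → Param d) (α : ℝ) (w₀ : Fin N → Param d)
    (w : Fin (L + 1) → Fin N → Param d) : Prop :=
  ∀ l i, w l i = w₀ i - ∑ p ∈ Finset.Iio l,
    adaptiveRate α (fun k => (N : ℝ)⁻¹ • ∑ j, G j (w k j)) (fun k => (N : ℝ)⁻¹ • ∑ j, w k j)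
      (fun k => w k i) p • ((N : ℝ)⁻¹ • ∑ j, G j (w p j))

theorem exists_isIterationSolution (hN : 1 ≤ N) {G : Fin N → Param d → Param d}
    (hG : ∀ i, Continuous (G i)) {α : ℝ} (h0 : 0 < α) (h1 : α ≤ 1) (w₀ : Fin N → Param d) :
    ∃ w : Fin (L + 1) → Fin N → Param d, IsIterationSolution G α w₀ w := by
  have hN' : (N : ℝ) ≠ 0 := by positivity
  have hc : 0 ≤ (1 - α) / α := div_nonneg (by linarith) h0.le
  set c := (1 - α) / α with hcdef
  set m : Param d := (N : ℝ)⁻¹ • ∑ i, w₀ i with hm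
  obtain ⟨φ, hφ⟩ := exists_feedback_equilibrium (L := L) hc (N : ℝ)⁻¹ m (fun i => w₀ i - m) hG
  set v : Fin N → Fin (L + 1) → Param d := fun i => feedbackTrajectory c φ (w₀ i - m) with hv
  have hsum : ∑ i, v i = 0 := by
    refine sum_feedbackTrajectory_eq_zero c φ ?_
    rw [Finset.sum_sub_distrib, Finset.sum_const, Finset.card_univ, Fintype.card_fin,
      ← Nat.cast_smul_eq_nsmul ℝ, hm, smul_inv_smul₀ hN', sub_self]
  have hmean : (fun k => (N : ℝ)⁻¹ • ∑ j, (m + v j k)) = fun _ : Fin (L + 1) => m := by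
    ext1 k
    have hk : ∑ j, v j k = 0 := by simpa using congrFun hsum k
    rw [Finset.sum_add_distrib, hk, Finset.sum_const, Finset.card_univ, Fintype.card_fin,
      ← Nat.cast_smul_eq_nsmul ℝ, add_zero, inv_smul_smul₀ hN']
  have htraj : ∀ i l, m + v i l
      = w₀ i - ∑ p ∈ Finset.Iio l, feedbackRate c φ (v i) p • φ p := by
    intro i l
    have h := congrFun (closedLoop_feedbackTrajectory hc φ (w₀ i - m)) l
    rw [closedLoop_apply] at h
    rw [eq_sub_iff_add_eq, add_assoc]
    exact add_eq_of_eq_sub' h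
  have hrate : ∀ i, adaptiveRate α φ (fun _ => m) (fun k => m + v i k)
      = feedbackRate c φ (v i) := by
    intro i
    -- By uniqueness of the rates it suffices that the feedback gains satisfy the rate equations,
    -- which is the summation by parts.
    refine ((isAdaptiveRate_iff h0 h1 _ _ _ _).mp fun l => ?_).symm
    have h := sum_Ioi_of_eq_sub_sum_Iio (htraj i) l
    simp only [smul_smul] at h
    rw [← h, ← Finset.sum_sub_distrib]
    simp only [add_sub_cancel_left]
    rfl
  refine ⟨fun l i => m + v i l, fun l i => ?_⟩
  rw [hmean, ← funext hφ, hrate]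
  refine (htraj i l).trans ?_
  congr 1
  exact Finset.sum_congr rfl fun p _ => by rw [hφ p]

theorem isFixedPt_Gamma_of_isIterationSolution {F : Fin N → Param d → ℝ} {α : ℝ}
    {start : Fin (T + 1) → Fin N → Param d} {w : Family N T L d}
    (hw : ∀ t, IsIterationSolution (fun i => gradient (F i)) α (start t) (w t)) :
    Function.IsFixedPt (Gamma F α start) (w, fun t l i => gradient (F i) (w t l i)) := by
  have h : newParam α start (w, fun t l i => gradient (F i) (w t l i)) = w := by
    ext1 t
    ext1 l
    ext1 i
    exact (hw t l i).symm
  simp only [Function.IsFixedPt, Gamma, h]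

theorem isSelfConsistent_of_isFixedPt_Gamma {F : Fin N → Param d → ℝ} {α : ℝ} (h0 : 0 < α)
    (h1 : α ≤ 1) {start : Fin (T + 1) → Fin N → Param d} {x : State N T L d}
    (hx : Function.IsFixedPt (Gamma F α start) x) :
    IsSelfConsistent F α start (phi1 x) (phi2 x) x.1 (rate α x) := by
  have hw : ∀ t l i, x.1 t l i
      = start t i - ∑ p ∈ Finset.Iio l, rate α x t p i • phi1 x t p := fun t l i =>
    congrFun (congrFun (congrFun (congrArg Prod.fst hx).symm t) l) i
  have hg : ∀ t l i, x.2 t l i = gradient (F i) (x.1 t l i) := by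
    intro t l i
    have h2 := congrFun (congrFun (congrFun (congrArg Prod.snd hx).symm t) l) i
    have h1 := congrFun (congrFun (congrFun (congrArg Prod.fst hx) t) l) i
    rw [h2, ← h1]
    rfl
  have hrate : ∀ t i, IsAdaptiveRate α (phi1 x t) (phi2 x t) (fun l => x.1 t l i)
      (fun l => rate α x t l i) := fun t i => (isAdaptiveRate_iff h0 h1 _ _ _ _).mpr rfl
  refine ⟨fun t l => ?_, fun t l => rfl, fun t i => ?_, hrate, fun t i => ?_, fun t l i => ?_⟩
  · simp only [phi1, clientMean, hg]
  · refine (hrate t i (Fin.last L)).trans ?_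
    have hIci : Finset.Ici (Fin.last L) = {Fin.last L} := by
      ext k
      simp [Fin.last_le_iff]
    have hIoi : Finset.Ioi (Fin.last L) = ∅ := by
      ext k
      simp [Fin.le_last]
    simp [hIci, hIoi]
  · rw [hw]
    simp [show Finset.Iio (0 : Fin (L + 1)) = ∅ by ext k; simp]
  · have hIio : Finset.Iio l.succ = insert l.castSucc (Finset.Iio l.castSucc) := by
      ext k
      simp only [Finset.mem_Iio, Finset.mem_insert, Fin.lt_def, Fin.ext_iff, Fin.val_succ,
        Fin.val_castSucc]
      omega
    rw [hw, hw t l.castSucc, hIio, Finset.sum_insert (by simp)]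
    abel

theorem continuous_gradient_of_contDiff {f : Param d → ℝ} (hf : ContDiff ℝ 1 f) :
    Continuous (gradient f) :=
  (InnerProductSpace.toDual ℝ (Param d)).symm.continuous.comp (hf.continuous_fderiv one_ne_zero)

end FedAgg

theorem theorem3 (N T L d : ℕ) (hN : 1 ≤ N) (F : Fin N → FedAgg.Param d → ℝ)
    (hF : ∀ i, ContDiff ℝ 1 (F i)) (α : ℝ) (hα0 : 0 < α) (hα1 : α ≤ 1) :
    (∀ start : Fin (T + 1) → Fin N → FedAgg.Param d,
      ∃ x : FedAgg.State N T L d,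
        Function.IsFixedPt (FedAgg.Gamma F α start) x ∧
        FedAgg.IsSelfConsistent F α start (FedAgg.phi1 x) (FedAgg.phi2 x) x.1
          (FedAgg.rate α x)) ∧
    (∀ D : Fin N → ℝ, (∀ i, 0 < D i) → ∀ w₀ : Fin N → FedAgg.Param d,
      ∃ x : FedAgg.State N T L d,
        Function.IsFixedPt
          (fun y => FedAgg.Gamma F α (FedAgg.aggregatedStart D w₀ y) y) x ∧
        FedAgg.IsSelfConsistent F α (FedAgg.aggregatedStart D w₀ x) (FedAgg.phi1 x)
          (FedAgg.phi2 x) x.1 (FedAgg.rate α x)) := by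
  choose W hW using FedAgg.exists_isIterationSolution (L := L) hN
    (fun i => FedAgg.continuous_gradient_of_contDiff (hF i)) hα0 hα1
  refine ⟨fun start => ?_, fun D _ w₀ => ?_⟩
  · have hx := FedAgg.isFixedPt_Gamma_of_isIterationSolution fun t => hW (start t)
    exact ⟨_, hx, FedAgg.isSelfConsistent_of_isFixedPt_Gamma hα0 hα1 hx⟩
  -- Aggregated onset parameters depend only on the previous iteration, so the solutions are built
  -- by recursion on `t`.
  · let s : ℕ → Fin (L + 1) → Fin N → FedAgg.Param d := fun n =>
      Nat.rec (W w₀) (fun _ u => W fun _ => ∑ j, (D j / ∑ k, D k) • u (Fin.last L) j) n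
    have hs : ∀ t : Fin (T + 1), FedAgg.IsIterationSolution (fun i => gradient (F i)) α
        (FedAgg.aggregatedStart D w₀ (fun t => s t, fun t l i => gradient (F i) (s t l i)) t)
        (s t) := by
      intro t
      refine Fin.cases (hW w₀) (fun n => ?_) t
      exact hW _
    have hx := FedAgg.isFixedPt_Gamma_of_isIterationSolution (T := T) hs
    exact ⟨_, hx, FedAgg.isSelfConsistent_of_isFixedPt_Gamma hα0 hα1 hx⟩
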